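/- **Conventions.** An indexed cover $\mathscr{U}=(U_i)_{i\in I}$ of a topological space $X$ is a family of subsets of $X$ with union $X$; write $U_J=\bigcap_{i\in J}U_i$. Its nerve $\operatorname{Nrv}(\mathscr{U})$ is the simplicial complex whose simplices are the nonempty finite $J\subseteq I$ with $U_J\neq\emptyset$, and $|\cdot|$ denotes geometric realization (with the weak topology). The blowup complex is the quotient space $$\operatorname{Blowup}(\mathscr{U})=\Big(\bigsqcup_{J\in\operatorname{Nrv}(\mathscr{U})}U_J\times|J|\Big)\Big/\sim,$$ where $|J|$ is the standard simplex with vertex set $J$ and, for all $J\subseteq J'$ in $\operatorname{Nrv}(\mathscr{U})$, the spaces $U_J\times|J|$ and $U_{J'}\times|J'|$ are identified along their common subspace $U_{J'}\times|J|$. The projections $U_J\times|J|\to U_J\subseteq X$ and $U_J\times|J|\to|J|\subseteq|\operatorname{Nrv}(\mathscr{U})|$ induce continuous maps $\rho_S\colon\operatorname{Blowup}(\mathscr{U})\to X$ and $\rho_N\colon\operatorname{Blowup}(\mathscr{U})\to|\operatorname{Nrv}(\mathscr{U})|$. A morphism of covered spaces $(f,\varphi)\colon(X,(U_i)_{i\in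 I})\to(Y,(V_\ell)_{\ell\in L})$ is a continuous map $f\colon X\to Y$ together with a map $\varphi\colon I\to L$ such that $f(U_i)\subseteq V_{\varphi(i)}$ for all $i\in I$. It induces a simplicial map $\varphi_*$ of nerves, $J\mapsto\varphi(J)$, and a map $\operatorname{Blowup}(f,\varphi)\colon\operatorname{Blowup}(\mathscr{U})\to\operatorname{Blowup}(\mathscr{V})$, given by $f\times|\varphi|\colon U_J\times|J|\to V_{\varphi(J)}\times|\varphi(J)|$ on the pieces. **Theorem.** Let $\mathscr{C}=(C_i)_{i\in I}$ be a finite family of closed convex subsets of $\mathbb{R}^d$ and let $X=\bigcup_{i\in I}C_i$. Then the maps $\rho_S\colon\operatorname{Blowup}(\mathscr{C})\to X$ and $\rho_N\colon\operatorname{Blowup}(\mathscr{C})\to|\operatorname{Nrv}(\mathscr{C})|$ are homotopy equivalences. Moreover, $\rho_S$ and $\rho_N$ are natural in morphisms of covered spaces: $\operatorname{Blowup}$ and $|\operatorname{Nrv}|$ preserve identities and composition of morphisms of arbitrary covered spaces, and for every morphism $(f,\varphi)\colon(X,\mathscr{U})\to(Y,\mathscr{V})$ of covered spaces $$\rho_S\circ\operatorname{Blowup}(f,\varphi)=f\circ\rho_S,\qquad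 \rho_N\circ\operatorname{Blowup}(f,\varphi)=|\varphi_*|\circ\rho_N .$$ -/

import Mathlib

/-! ### Geometric realization of simplicial complexes -/

/-- The points of the geometric realization of an abstract simplicial complex `K`, in barycentric
coordinates: finitely supported families of nonnegative reals with sum `1` whose support is a
simplex of `K`. -/
def IsRealizationPoint {ι : Type*} (K : PreAbstractSimplicialComplex ι) (x : ι →₀ ℝ) : Prop :=
  x.support ∈ K.faces ∧ (∀ i, 0 ≤ x i) ∧ (x.sum fun _ r => r) = 1

/-- The geometric realization `|K|`. -/
def Realization {ι : Type*} (K : PreAbstractSimplicialComplex ι) : Type _ :=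
  {x : ι →₀ ℝ // IsRealizationPoint K x}

open Classical in
theorem isRealizationPoint_mapDomain {κ ι : Type*} {L : PreAbstractSimplicialComplex ι}
    (φ : κ → ι) (x : κ →₀ ℝ) (h0 : ∀ i, 0 ≤ x i) (h1 : (x.sum fun _ r => r) = 1)
    (hs : x.support.image φ ∈ L.faces) : IsRealizationPoint L (x.mapDomain φ) := by
  have hsum : ((x.mapDomain φ).sum fun _ r => r) = 1 := by
    rw [Finsupp.sum_mapDomain_index (fun _ => rfl) (fun _ _ _ => rfl)]
    exact h1
  refine ⟨?_, ?_, hsum⟩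
  · refine (L.isRelLowerSet_faces hs).2 Finsupp.mapDomain_support ?_
    rw [Finsupp.support_nonempty_iff]
    rintro h
    rw [h] at hsum
    simp at hsum
  · intro i
    simp only [Finsupp.mapDomain, Finsupp.sum, Finsupp.finsetSum_apply]
    refine Finset.sum_nonneg fun j _ => ?_
    rw [Finsupp.single_apply]
    split_ifs
    · exact h0 j
    · exact le_rfl

/-- The inclusion of the closed simplex `|s|` into `|K|`, for a simplex `s` of `K`: barycentric
coordinates are extended by zero. Here `stdSimplex ℝ s` is the standard simplex with vertex
set `s`. -/
noncomputable def Realization.face {ι : Type*} (K : PreAbstractSimplicialComplex ι)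
    (s : {s : Finset ι // s ∈ K.faces}) (α : stdSimplex ℝ s.1) : Realization K :=
  ⟨(Finsupp.equivFunOnFinite.symm α.1).mapDomain Subtype.val, by
    have h1 : ((Finsupp.equivFunOnFinite.symm α.1).sum fun _ r => r) = 1 := by
      rw [Finsupp.sum_fintype _ _ (fun _ => rfl)]
      exact α.2.2
    classical
    refine isRealizationPoint_mapDomain _ _ (fun i => α.2.1 i) h1 ?_
    refine (K.isRelLowerSet_faces s.2).2 ?_ ?_
    · intro i hi
      obtain ⟨j, -, rfl⟩ := Finset.mem_image.mp hi
      exact j.2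
    · rw [Finset.image_nonempty, Finsupp.support_nonempty_iff]
      intro h
      rw [h] at h1
      simp at h1⟩

/-- `|K|` carries the weak (coherent) topology: the finest topology for which the inclusions of
all closed simplices are continuous. -/
noncomputable instance Realization.instTopologicalSpace {ι : Type*} (K : PreAbstractSimplicialComplex ι) :
    TopologicalSpace (Realization K) :=
  ⨆ s : {s : Finset ι // s ∈ K.faces},
    TopologicalSpace.coinduced (Realization.face K s) inferInstance

theorem Realization.continuous_face {ι : Type*} (K : PreAbstractSimplicialComplex ι)
    (s : {s : Finset ι // s ∈ K.faces}) : Continuous (Realization.face K s) :=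
  continuous_iff_coinduced_le.mpr
    (le_iSup (fun s : {s : Finset ι // s ∈ K.faces} =>
      TopologicalSpace.coinduced (Realization.face K s) inferInstance) s)

open Classical in
/-- A vertex map is simplicial if it sends simplices to simplices. -/
def IsSimplicialMap {ι κ : Type*} (K : PreAbstractSimplicialComplex ι)
    (L : PreAbstractSimplicialComplex κ) (φ : ι → κ) : Prop :=
  ∀ s ∈ K.faces, s.image φ ∈ L.faces

open Classical in
theorem Realization.mapDomain_face {ι κ : Type*} {K : PreAbstractSimplicialComplex ι}
    {L : PreAbstractSimplicialComplex κ} (φ : ι → κ)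
    (s : {s : Finset ι // s ∈ K.faces}) (t : {t : Finset κ // t ∈ L.faces})
    (h : ∀ i ∈ s.1, φ i ∈ t.1) (α : stdSimplex ℝ s.1) :
    (Realization.face K s α).1.mapDomain φ =
      (Realization.face L t (stdSimplex.map (fun i : s.1 => ⟨φ i.1, h i.1 i.2⟩) α)).1 := by
  have key : Finsupp.equivFunOnFinite.symm
      (stdSimplex.map (S := ℝ) (fun i : s.1 => (⟨φ i.1, h i.1 i.2⟩ : t.1)) α).1 =
      (Finsupp.equivFunOnFinite.symm α.1).mapDomain (fun i : s.1 => (⟨φ i.1, h i.1 i.2⟩ : t.1)) :=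
    Finsupp.equivFunOnFinite.symm_apply_apply _
  simp only [Realization.face]
  rw [key, ← Finsupp.mapDomain_comp, ← Finsupp.mapDomain_comp]
  rfl

/-- The map `|φ| : |K| → |L|` induced by a simplicial map `φ`, affine linear on each simplex. -/
noncomputable def Realization.map {ι κ : Type*} {K : PreAbstractSimplicialComplex ι}
    {L : PreAbstractSimplicialComplex κ} (φ : ι → κ) (hφ : IsSimplicialMap K L φ) :
    C(Realization K, Realization L) where
  toFun x := ⟨x.1.mapDomain φ,
    isRealizationPoint_mapDomain φ x.1 x.2.2.1 x.2.2.2 (hφ _ x.2.1)⟩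
  continuous_toFun := by
    classical
    refine continuous_iSup_dom.mpr fun s => continuous_coinduced_dom.mpr ?_
    have h : ∀ i ∈ s.1, φ i ∈ s.1.image φ := fun i hi => Finset.mem_image_of_mem φ hi
    have hs : s.1.image φ ∈ L.faces := by
      convert hφ s.1 s.2
    have := (Realization.continuous_face L ⟨_, hs⟩).comp
      (stdSimplex.continuous_map (S := ℝ) (fun i : s.1 => (⟨φ i.1, h i.1 i.2⟩ : s.1.image φ)))
    refine this.congr fun α => Subtype.ext ?_
    exact (Realization.mapDomain_face φ s ⟨_, hs⟩ h α).symm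

/-! ### Covered spaces -/

/-- An indexed cover `(U i)_{i ∈ I}` of `X`. No openness, closedness or finiteness is required,
and cover elements may be empty or repeated. -/
structure IndexedCover (I X : Type*) where
  /-- the cover elements -/
  set : I → Set X
  iUnion_eq : ⋃ i, set i = Set.univ

namespace IndexedCover

/-- The intersection `U_J` of the cover elements with index in `J`. -/
def inter {I X : Type*} (U : IndexedCover I X) (J : Finset I) : Set X :=
  ⋂ i ∈ J, U.set i

theorem inter_anti {I X : Type*} (U : IndexedCover I X) {J J' : Finset I} (h : J ⊆ J') :
    U.inter J' ⊆ U.inter J :=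
  Set.biInter_subset_biInter_left h

/-- The nerve of a cover: its simplices are the nonempty finite `J ⊆ I` with `U_J ≠ ∅`. -/
def nerve {I X : Type*} (U : IndexedCover I X) : PreAbstractSimplicialComplex I where
  faces := {J | J.Nonempty ∧ (U.inter J).Nonempty}
  isRelLowerSet_faces _ hJ := ⟨hJ.1, fun _ h hne => ⟨hne, hJ.2.mono (U.inter_anti h)⟩⟩

/-- A morphism of covered spaces `(f, φ) : (X, U) → (Y, V)`. -/
structure Hom {I X L Y : Type*} [TopologicalSpace X] [TopologicalSpace Y]
    (U : IndexedCover I X) (V : IndexedCover L Y) where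
  /-- the underlying continuous map `f` -/
  map : C(X, Y)
  /-- the map of index sets `φ` -/
  index : I → L
  /-- `f` is carried by `φ` -/
  carried : ∀ i, map '' U.set i ⊆ V.set (index i)

/-- The identity morphism. -/
def Hom.id {I X : Type*} [TopologicalSpace X] (U : IndexedCover I X) : Hom U U where
  map := ContinuousMap.id X
  index := _root_.id
  carried i := by simp

/-- The composite `g ∘ f` of morphisms of covered spaces. -/
def Hom.comp {I X L Y M Z : Type*} [TopologicalSpace X] [TopologicalSpace Y] [TopologicalSpace Z]
    {U : IndexedCover I X} {V : IndexedCover L Y} {W : IndexedCover M Z}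
    (g : Hom V W) (f : Hom U V) : Hom U W where
  map := g.map.comp f.map
  index := g.index ∘ f.index
  carried i := by
    rintro _ ⟨x, hx, rfl⟩
    exact g.carried _ ⟨_, f.carried i ⟨x, hx, rfl⟩, rfl⟩

open Classical in
theorem Hom.map_mem_inter {I X L Y : Type*} [TopologicalSpace X] [TopologicalSpace Y]
    {U : IndexedCover I X} {V : IndexedCover L Y} (f : Hom U V) (J : Finset I) {x : X}
    (hx : x ∈ U.inter J) : f.map x ∈ V.inter (J.image f.index) := by
  simp only [inter, Set.mem_iInter] at hx ⊢
  intro l hl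
  obtain ⟨i, hi, rfl⟩ := Finset.mem_image.mp hl
  exact f.carried i ⟨x, hx i hi, rfl⟩

theorem Hom.isSimplicialMap {I X L Y : Type*} [TopologicalSpace X] [TopologicalSpace Y]
    {U : IndexedCover I X} {V : IndexedCover L Y} (f : Hom U V) :
    IsSimplicialMap U.nerve V.nerve f.index := by
  classical
  rintro s ⟨hne, x, hx⟩
  exact ⟨hne.image _, _, f.map_mem_inter s hx⟩

/-- The map `|φ_*| : |Nrv U| → |Nrv V|` induced by a morphism of covered spaces. -/
noncomputable def Hom.nerveMap {I X L Y : Type*} [TopologicalSpace X] [TopologicalSpace Y]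
    {U : IndexedCover I X} {V : IndexedCover L Y} (f : Hom U V) :
    C(Realization U.nerve, Realization V.nerve) :=
  Realization.map f.index f.isSimplicialMap

/-! ### The blowup complex -/

/-- The disjoint union of the spaces `U_J × |J|` over all simplices `J` of the nerve. -/
abbrev BlowupPieces {I X : Type*} (U : IndexedCover I X) : Type _ :=
  Σ J : {J : Finset I // J ∈ U.nerve.faces}, U.inter J.1 × stdSimplex ℝ J.1

/-- The gluing relation: for simplices `J ⊆ J'` of the nerve, a point `(x, α) ∈ U_{J'} × |J|`
gives points of `U_{J'} × |J'|` and of `U_J × |J|`, and these are identified. -/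
inductive BlowupRel {I X : Type*} (U : IndexedCover I X) : BlowupPieces U → BlowupPieces U → Prop
  | glue (J J' : {J : Finset I // J ∈ U.nerve.faces}) (h : J.1 ⊆ J'.1) (x : U.inter J'.1)
      (α : stdSimplex ℝ J.1) :
      BlowupRel U ⟨J', x, stdSimplex.map (fun i : J.1 => (⟨i.1, h i.2⟩ : J'.1)) α⟩
        ⟨J, ⟨x.1, U.inter_anti h x.2⟩, α⟩

/-- The blowup complex: the quotient space of the disjoint union of the `U_J × |J|` by the
equivalence relation generated by the gluing relation. -/
def Blowup {I X : Type*} (U : IndexedCover I X) : Type _ :=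
  Quot (BlowupRel U)

instance Blowup.instTopologicalSpace {I X : Type*} [TopologicalSpace X] (U : IndexedCover I X) :
    TopologicalSpace (Blowup U) :=
  inferInstanceAs (TopologicalSpace (Quot (BlowupRel U)))

/-- The natural map `ρ_S : Blowup U → X`, induced by the projections `U_J × |J| → U_J ⊆ X`. -/
def rhoS {I X : Type*} [TopologicalSpace X] (U : IndexedCover I X) : C(Blowup U, X) where
  toFun := Quot.lift (fun p => (p.2.1 : X)) (by rintro _ _ ⟨⟩; rfl)
  continuous_toFun := continuous_quot_lift _ <| continuous_sigma fun _ =>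
    continuous_subtype_val.comp continuous_fst

/-- The natural map `ρ_N : Blowup U → |Nrv U|`, induced by the projections
`U_J × |J| → |J| ⊆ |Nrv U|`. -/
noncomputable def rhoN {I X : Type*} [TopologicalSpace X] (U : IndexedCover I X) :
    C(Blowup U, Realization U.nerve) where
  toFun := Quot.lift (fun p => Realization.face U.nerve p.1 p.2.2) (by
    rintro _ _ ⟨J, J', h, x, α⟩
    refine Subtype.ext ((Realization.mapDomain_face _root_.id J J' (fun i hi => h hi) α).symm.trans
      Finsupp.mapDomain_id))
  continuous_toFun := continuous_quot_lift _ <| continuous_sigma fun J =>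
    (Realization.continuous_face U.nerve J).comp continuous_snd

open Classical in
/-- The map `Blowup U → Blowup V` induced by a morphism of covered spaces `(f, φ)`: it is given by
`f × |φ| : U_J × |J| → V_{φ(J)} × |φ(J)|` on the pieces. -/
noncomputable def Hom.blowupMap {I X L Y : Type*} [TopologicalSpace X] [TopologicalSpace Y]
    {U : IndexedCover I X} {V : IndexedCover L Y} (f : Hom U V) : C(Blowup U, Blowup V) where
  toFun := Quot.lift
    (fun p => Quot.mk (BlowupRel V)
      ⟨⟨p.1.1.image f.index, f.isSimplicialMap _ p.1.2⟩,
        ⟨f.map p.2.1, f.map_mem_inter p.1.1 p.2.1.2⟩,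
        stdSimplex.map (fun i : p.1.1 =>
          (⟨f.index i.1, Finset.mem_image_of_mem _ i.2⟩ : p.1.1.image f.index)) p.2.2⟩)
    (by
      rintro _ _ ⟨J, J', h, x, α⟩
      have := BlowupRel.glue (U := V) ⟨J.1.image f.index, f.isSimplicialMap _ J.2⟩
        ⟨J'.1.image f.index, f.isSimplicialMap _ J'.2⟩ (Finset.image_subset_image h)
        ⟨f.map x, f.map_mem_inter J'.1 x.2⟩
        (stdSimplex.map (fun i : J.1 =>
          (⟨f.index i.1, Finset.mem_image_of_mem _ i.2⟩ : J.1.image f.index)) α)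
      refine Eq.trans ?_ (Quot.sound this)
      simp only [stdSimplex.map_comp_apply]
      rfl)
  continuous_toFun := by
    refine continuous_quot_lift _ (continuous_sigma fun J => ?_)
    have h1 : Continuous fun p : U.inter J.1 × stdSimplex ℝ J.1 =>
        (⟨f.map p.1, f.map_mem_inter J.1 p.1.2⟩ : V.inter (J.1.image f.index)) :=
      (f.map.continuous.comp (continuous_subtype_val.comp continuous_fst)).subtype_mk _
    have h2 : Continuous fun p : U.inter J.1 × stdSimplex ℝ J.1 =>
        stdSimplex.map (S := ℝ) (fun i : J.1 =>
          (⟨f.index i.1, Finset.mem_image_of_mem _ i.2⟩ : J.1.image f.index)) p.2 :=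
      (stdSimplex.continuous_map (S := ℝ) _).comp continuous_snd
    exact (continuous_quot_mk (r := BlowupRel V)).comp ((continuous_sigmaMk
      (σ := fun J : {J : Finset L // J ∈ V.nerve.faces} => V.inter J.1 × stdSimplex ℝ J.1)
      (i := ⟨J.1.image f.index, f.isSimplicialMap _ J.2⟩)).comp (h1.prodMk h2))

end IndexedCover

/-- A continuous map is a homotopy equivalence if it has a homotopy inverse. -/
def IsHomotopyEquiv {X Y : Type*} [TopologicalSpace X] [TopologicalSpace Y] (f : C(X, Y)) : Prop :=
  ∃ e : ContinuousMap.HomotopyEquiv X Y, e.toFun = f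

/-!
For a finite closed cover of `X ⊆ E`, the blowup complex embeds into `E × (I → ℝ)`
(`IndexedCover.isEmbedding_ambientCoord`): its image is the set `blowupModel` of the pairs `(x, a)`
of a point and barycentric coordinates such that `x` lies in every cover element `i` with `a i ≠ 0`.
Under this embedding `ρ_S` and `ρ_N` become the two projections, and for convex cover elements the
fibres of both projections are convex. It therefore suffices to find continuous maps backwards; all
homotopies are straight-line homotopies, first in one variable and then in the other.

Both backward maps come from one selection, `exists_continuousOn_selection`. Given weights
`b : I → ℝ` whose support indexes sets with a common point, it truncates `b` at a level `T > 0` and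
normalizes to obtain coordinates supported on `{T < b}`. It also averages chosen points
`p J ∈ ⋂ i ∈ J, C i` over the sets `J` between `{T ≤ b}` and `{0 < b}`, with weights vanishing for
all other `J`; by convexity the average lies in `⋂ i ∈ {T ≤ b}, C i`.

* For `ρ_N` the weights are the barycentric coordinates themselves
  (`IndexedCover.isHomotopyEquiv_rhoN`). Truncation shrinks supports, so that the truncated
  coordinates can be joined to the original ones over the same base point.
* For `ρ_S` the weights are bump functions around the cover elements whose supports have the same
  nerve as the cover (`exists_bump_of_isClosed`, `IndexedCover.isHomotopyEquiv_rhoS`). As these are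
  `1` on the cover elements, the selected point lies in every cover element that contains the given
  point, and the segment between the two points stays inside `X`.

Functoriality and naturality are checked on representatives. Iterated images of a simplex under
index maps agree only propositionally, and the gluing relation bridges the difference.
-/

section

open Set Topology

/-! ### Straight-line homotopies -/

/-- Two maps into a space embedded in a real topological vector space are homotopic as soon as the
segments joining their values stay inside the image of the embedding. -/
theorem ContinuousMap.homotopic_of_segment_subset_range {W Z V : Type*} [TopologicalSpace W]
    [TopologicalSpace Z] [AddCommGroup V] [Module ℝ V] [TopologicalSpace V]
    [IsTopologicalAddGroup V] [ContinuousSMul ℝ V] {e : Z → V} (he : IsEmbedding e) {f g : C(W, Z)}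
    (h : ∀ w, segment ℝ (e (f w)) (e (g w)) ⊆ range e) : f.Homotopic g := by
  have h' : ∀ p : unitInterval × W,
      ∃ z, e z = AffineMap.lineMap (e (f p.2)) (e (g p.2)) (p.1 : ℝ) := fun p =>
    h p.2 (segment_eq_image_lineMap ℝ (e (f p.2)) (e (g p.2)) ▸ mem_image_of_mem _ p.1.2)
  choose G hG using h'
  refine ⟨⟨⟨G, ?_⟩, fun w => he.injective ?_, fun w => he.injective ?_⟩⟩
  · rw [he.continuous_iff]
    have : e ∘ G = fun p : unitInterval × W =>
        (p.1 : ℝ) • (e (g p.2) - e (f p.2)) + e (f p.2) := by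
      funext p
      simp [hG, AffineMap.lineMap_apply]
    rw [this]
    have := he.continuous
    fun_prop
  · simp [hG]
  · simp [hG]

/-- A continuous map into the image of an embedding lifts continuously. -/
theorem Topology.IsEmbedding.exists_lift {W Z V : Type*} [TopologicalSpace W]
    [TopologicalSpace Z] [TopologicalSpace V] {e : Z → V} (he : IsEmbedding e) {f : W → V}
    (hf : Continuous f) (h : ∀ w, f w ∈ range e) : ∃ g : C(W, Z), ∀ w, e (g w) = f w := by
  choose G hG using h
  exact ⟨⟨G, he.continuous_iff.2 (hf.congr fun w => (hG w).symm)⟩, hG⟩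

theorem IsHomotopyEquiv.of_homotopic {X Y : Type*} [TopologicalSpace X] [TopologicalSpace Y]
    {f : C(X, Y)} (g : C(Y, X)) (hl : (g.comp f).Homotopic (ContinuousMap.id X))
    (hr : (f.comp g).Homotopic (ContinuousMap.id Y)) : IsHomotopyEquiv f :=
  ⟨⟨f, g, hl, hr⟩, rfl⟩

/-! ### Barycentric coordinates on the geometric realization -/

namespace Realization

variable {ι : Type*} {K : PreAbstractSimplicialComplex ι}

theorem face_apply_of_mem (s : {s : Finset ι // s ∈ K.faces}) (α : stdSimplex ℝ s.1) (i : s.1) :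
    (face K s α).1 i = α.1 i :=
  Finsupp.mapDomain_apply Subtype.val_injective _ i

theorem face_apply_of_notMem (s : {s : Finset ι // s ∈ K.faces}) (α : stdSimplex ℝ s.1) {i : ι}
    (hi : i ∉ s.1) : (face K s α).1 i = 0 :=
  Finsupp.mapDomain_of_notMem_range _ _ (by simpa using hi)

theorem face_injective (s : {s : Finset ι // s ∈ K.faces}) : Function.Injective (face K s) := by
  intro α β h
  refine Subtype.ext (funext fun i => ?_)
  rw [← face_apply_of_mem, ← face_apply_of_mem, h]

theorem support_face_subset (s : {s : Finset ι // s ∈ K.faces}) (α : stdSimplex ℝ s.1) :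
    (face K s α).1.support ⊆ s.1 := by
  intro i hi
  by_contra h
  exact Finsupp.mem_support_iff.1 hi (face_apply_of_notMem s α h)

theorem exists_face_eq (x : Realization K) :
    ∃ α : stdSimplex ℝ x.1.support, face K ⟨x.1.support, x.2.1⟩ α = x := by
  refine ⟨⟨fun i => x.1 i, fun i => x.2.2.1 i, ?_⟩, Subtype.ext (Finsupp.ext fun i => ?_)⟩
  · rw [Finset.sum_coe_sort x.1.support fun i => x.1 i]
    exact x.2.2.2
  · by_cases hi : i ∈ x.1.support
    · exact face_apply_of_mem (K := K) ⟨x.1.support, x.2.1⟩ _ ⟨i, hi⟩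
    · rw [face_apply_of_notMem _ _ hi, Finsupp.notMem_support_iff.1 hi]

theorem face_map_inclusion {s t : {s : Finset ι // s ∈ K.faces}} (h : s.1 ⊆ t.1)
    (α : stdSimplex ℝ s.1) :
    face K t (stdSimplex.map (fun i : s.1 => (⟨i.1, h i.2⟩ : t.1)) α) = face K s α :=
  Subtype.ext ((mapDomain_face _root_.id s t (fun _ hi => h hi) α).symm.trans Finsupp.mapDomain_id)

/-- The barycentric coordinates of a point of `|K|`. -/
def coord (x : Realization K) : ι → ℝ := x.1

theorem coord_injective : Function.Injective (coord (K := K)) := fun _ _ h =>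
  Subtype.ext (DFunLike.coe_injective h)

theorem continuous_coord_face (s : {s : Finset ι // s ∈ K.faces}) :
    Continuous fun α => coord (face K s α) := by
  refine continuous_pi fun i => ?_
  by_cases hi : i ∈ s.1
  · exact ((continuous_apply (⟨i, hi⟩ : s.1)).comp continuous_subtype_val).congr fun α =>
      (face_apply_of_mem s α ⟨i, hi⟩).symm
  · exact continuous_const.congr fun α => (face_apply_of_notMem s α hi).symm

theorem continuous_coord : Continuous (coord (K := K)) :=
  continuous_iSup_dom.mpr fun s => continuous_coinduced_dom.mpr (continuous_coord_face s)

theorem isClosedEmbedding_coord_face (s : {s : Finset ι // s ∈ K.faces}) :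
    IsClosedEmbedding fun α => coord (face K s α) :=
  (continuous_coord_face s).isClosedEmbedding (coord_injective.comp (face_injective s))

/-- For a finite complex the weak topology is the one induced by barycentric coordinates. -/
theorem isClosedEmbedding_coord [Finite ι] : IsClosedEmbedding (coord (K := K)) := by
  refine .of_continuous_injective_isClosedMap continuous_coord coord_injective fun Z hZ => ?_
  have : coord '' Z = ⋃ s, (fun α => coord (face K s α)) '' (face K s ⁻¹' Z) := by
    ext a
    simp only [mem_image, mem_iUnion, mem_preimage]
    constructor
    · rintro ⟨x, hx, rfl⟩
      obtain ⟨α, hα⟩ := exists_face_eq x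
      exact ⟨⟨_, x.2.1⟩, α, by rwa [hα], by rw [hα]⟩
    · rintro ⟨s, α, hα, rfl⟩
      exact ⟨_, hα, rfl⟩
  rw [this]
  exact isClosed_iUnion_of_finite fun s =>
    (isClosedEmbedding_coord_face s).isClosedMap _ (hZ.preimage (continuous_face K s))

theorem coord_mem_stdSimplex [Fintype ι] (x : Realization K) : coord x ∈ stdSimplex ℝ ι := by
  refine ⟨x.2.2.1, ?_⟩
  have h := x.2.2.2
  rwa [Finsupp.sum_fintype _ _ (fun _ => rfl)] at h

theorem exists_coord_eq [Fintype ι] {a : ι → ℝ} (ha : a ∈ stdSimplex ℝ ι)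
    (hs : (Finsupp.equivFunOnFinite.symm a).support ∈ K.faces) :
    ∃ x : Realization K, coord x = a :=
  ⟨⟨Finsupp.equivFunOnFinite.symm a, hs, ha.1, by
    rw [Finsupp.sum_fintype _ _ (fun _ => rfl)]; exact ha.2⟩, rfl⟩

end Realization

/-! ### The blowup complex as a subspace of a product -/

namespace IndexedCover

section Embedding

variable {I X : Type*} [TopologicalSpace X] (U : IndexedCover I X)

/-- The point of `X` and the barycentric coordinates underlying a point of the blowup complex. -/
noncomputable def blowupCoord (z : Blowup U) : X × (I → ℝ) :=
  (U.rhoS z, (U.rhoN z).coord)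

variable {U}

/-- Passing to the smallest simplex that carries a point, every point of the blowup complex is
represented by a family of strictly positive barycentric coordinates. -/
theorem exists_rep_support (z : Blowup U) :
    ∃ (J : {J : Finset I // J ∈ U.nerve.faces}) (x : U.inter J.1) (α : stdSimplex ℝ J.1),
      Quot.mk (BlowupRel U) ⟨J, x, α⟩ = z ∧ J.1 = (U.rhoN z).1.support := by
  obtain ⟨⟨J, x, α⟩, rfl⟩ := Quot.exists_rep z
  obtain ⟨β, hβ⟩ := Realization.exists_face_eq (Realization.face U.nerve J α)
  have hsub := Realization.support_face_subset J α
  have hα : stdSimplex.map (fun i => (⟨i.1, hsub i.2⟩ : J.1)) β = α :=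
    Realization.face_injective J ((Realization.face_map_inclusion
      (s := ⟨_, (Realization.face U.nerve J α).2.1⟩) hsub β).trans hβ)
  refine ⟨⟨_, (Realization.face U.nerve J α).2.1⟩, ⟨x.1, U.inter_anti hsub x.2⟩, β, ?_, rfl⟩
  have := Quot.sound (BlowupRel.glue ⟨_, (Realization.face U.nerve J α).2.1⟩ J hsub x β)
  rw [hα] at this
  exact this.symm

theorem blowupCoord_injective : Function.Injective U.blowupCoord := by
  intro z z' h
  obtain ⟨J, x, α, hz, hJ⟩ := exists_rep_support z
  obtain ⟨J', x', α', hz', hJ'⟩ := exists_rep_support z'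
  have hN : U.rhoN z = U.rhoN z' := Realization.coord_injective (Prod.ext_iff.1 h).2
  obtain rfl : J = J' := Subtype.ext (by rw [hJ, hJ', hN])
  have hx : x = x' := Subtype.ext (by
    have := (Prod.ext_iff.1 h).1
    rw [← hz, ← hz'] at this
    exact this)
  have hα : α = α' := Realization.face_injective J (by
    rw [← hz, ← hz'] at hN
    exact hN)
  rw [← hz, ← hz', hx, hα]

theorem continuous_blowupCoord : Continuous U.blowupCoord :=
  U.rhoS.continuous.prodMk (Realization.continuous_coord.comp U.rhoN.continuous)

/-- For a finite closed cover, the quotient topology on the blowup complex is the subspace topology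
of the product of `X` with the space of barycentric coordinates. -/
theorem isClosedEmbedding_blowupCoord [Finite I] (hU : ∀ i, IsClosed (U.set i)) :
    IsClosedEmbedding U.blowupCoord := by
  refine .of_continuous_injective_isClosedMap continuous_blowupCoord blowupCoord_injective
    fun Z hZ => ?_
  have : U.blowupCoord '' Z = ⋃ J : {J : Finset I // J ∈ U.nerve.faces},
      Prod.map (Subtype.val : U.inter J.1 → X)
        (fun α => Realization.coord (Realization.face U.nerve J α)) ''
        ((fun p => (Quot.mk (BlowupRel U) ⟨J, p⟩ : Blowup U)) ⁻¹' Z) := by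
    ext a
    simp only [mem_image, mem_iUnion]
    constructor
    · rintro ⟨z, hz, rfl⟩
      obtain ⟨⟨J, p⟩, rfl⟩ := Quot.exists_rep z
      exact ⟨J, p, hz, rfl⟩
    · rintro ⟨J, p, hp, rfl⟩
      exact ⟨_, hp, rfl⟩
  rw [this]
  refine isClosed_iUnion_of_finite fun J => ?_
  have hJ : IsClosed (U.inter J.1) := isClosed_biInter fun i _ => hU i
  exact (hJ.isClosedEmbedding_subtypeVal.prodMap
    (Realization.isClosedEmbedding_coord_face J)).isClosedMap _
    (hZ.preimage (continuous_quot_mk.comp continuous_sigmaMk))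

theorem range_blowupCoord [Fintype I] :
    range U.blowupCoord = {q | q.2 ∈ stdSimplex ℝ I ∧ ∀ i, q.2 i ≠ 0 → q.1 ∈ U.set i} := by
  ext ⟨x, a⟩
  constructor
  · rintro ⟨z, hz⟩
    obtain ⟨J, y, α, rfl, hJ⟩ := exists_rep_support z
    obtain ⟨rfl, rfl⟩ := Prod.ext_iff.1 hz
    refine ⟨Realization.coord_mem_stdSimplex _, fun i hi => ?_⟩
    exact mem_iInter₂.1 y.2 i (hJ ▸ Finsupp.mem_support_iff.2 hi)
  · rintro ⟨ha, hx⟩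
    set s := (Finsupp.equivFunOnFinite.symm a).support with hs
    have hxs : x ∈ U.inter s := mem_iInter₂.2 fun i hi => hx i (Finsupp.mem_support_iff.1 hi)
    have hne : s.Nonempty := by
      rw [hs, Finsupp.support_nonempty_iff]
      intro h0
      have h1 : a = 0 := congrArg DFunLike.coe h0
      have h2 : ∑ i, a i = 1 := ha.2
      simp [h1] at h2
    have hK : s ∈ U.nerve.faces := ⟨hne, x, hxs⟩
    obtain ⟨y, hy⟩ := Realization.exists_coord_eq ha hK
    have hys : y.1.support = s := by
      have : y.1 = Finsupp.equivFunOnFinite.symm a := DFunLike.coe_injective hy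
      rw [this]
    obtain ⟨α, hα⟩ := Realization.exists_face_eq y
    exact ⟨Quot.mk _ ⟨⟨_, y.2.1⟩, ⟨x, (congrArg U.inter hys).symm ▸ hxs⟩, α⟩, Prod.ext rfl
      ((congrArg Realization.coord hα).trans hy)⟩

end Embedding

theorem surjective_rhoN {I X : Type*} [TopologicalSpace X] (U : IndexedCover I X) :
    Function.Surjective U.rhoN := by
  intro y
  obtain ⟨α, hα⟩ := Realization.exists_face_eq y
  obtain ⟨x, hx⟩ := y.2.1.2
  exact ⟨Quot.mk _ ⟨⟨_, y.2.1⟩, ⟨x, hx⟩, α⟩, hα⟩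

/-! ### Functoriality and naturality -/

section Functoriality

variable {I X L Y M Z : Type*} [TopologicalSpace X] [TopologicalSpace Y] [TopologicalSpace Z]
  {U : IndexedCover I X} {V : IndexedCover L Y} {W : IndexedCover M Z}

theorem Hom.blowupMap_id (U : IndexedCover I X) :
    (Hom.id U).blowupMap = ContinuousMap.id _ := by
  classical
  ext z
  obtain ⟨⟨J, x, α⟩, rfl⟩ := Quot.exists_rep z
  have h : J.1 ⊆ J.1.image (Hom.id U).index := fun i hi => Finset.mem_image.2 ⟨i, hi, rfl⟩
  exact Quot.sound (BlowupRel.glue J ⟨_, (Hom.id U).isSimplicialMap _ J.2⟩ h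
    ⟨x, (Hom.id U).map_mem_inter J.1 x.2⟩ α)

theorem Hom.nerveMap_id (U : IndexedCover I X) :
    (Hom.id U).nerveMap = ContinuousMap.id _ := by
  ext y
  exact Subtype.ext Finsupp.mapDomain_id

theorem Hom.blowupMap_comp (g : Hom V W) (f : Hom U V) :
    (g.comp f).blowupMap = g.blowupMap.comp f.blowupMap := by
  classical
  ext z
  obtain ⟨⟨J, x, α⟩, rfl⟩ := Quot.exists_rep z
  have h : J.1.image (g.comp f).index ⊆ (J.1.image f.index).image g.index := by
    rw [Finset.image_image]; rfl
  have := Quot.sound (BlowupRel.glue ⟨_, (g.comp f).isSimplicialMap _ J.2⟩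
    ⟨_, g.isSimplicialMap _ (f.isSimplicialMap _ J.2)⟩ h
    ⟨g.map (f.map x), g.map_mem_inter _ (f.map_mem_inter J.1 x.2)⟩
    (stdSimplex.map (fun i : J.1 => (⟨(g.comp f).index i.1, Finset.mem_image_of_mem _ i.2⟩ :
      J.1.image (g.comp f).index)) α))
  refine Eq.trans this.symm ?_
  simp only [stdSimplex.map_comp_apply]
  refine congrArg (Quot.mk _) ?_
  simp only [stdSimplex.map_comp_apply]
  rfl

theorem Hom.nerveMap_comp (g : Hom V W) (f : Hom U V) :
    (g.comp f).nerveMap = g.nerveMap.comp f.nerveMap := by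
  ext y
  exact Subtype.ext (Finsupp.mapDomain_comp (f := f.index) (g := g.index) (v := y.1))

theorem rhoS_comp_blowupMap (f : Hom U V) : V.rhoS.comp f.blowupMap = f.map.comp U.rhoS := by
  ext z
  obtain ⟨p, rfl⟩ := Quot.exists_rep z
  rfl

theorem rhoN_comp_blowupMap (f : Hom U V) : V.rhoN.comp f.blowupMap = f.nerveMap.comp U.rhoN := by
  classical
  ext z
  obtain ⟨⟨J, x, α⟩, rfl⟩ := Quot.exists_rep z
  exact Subtype.ext (Realization.mapDomain_face f.index J ⟨_, f.isSimplicialMap _ J.2⟩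
    (fun i hi => Finset.mem_image_of_mem _ hi) α).symm

end Functoriality

end IndexedCover

/-! ### A continuous selection for convex sets -/

/-- Pairs of a point `x` and barycentric coordinates `a` with `x ∈ C i` whenever `a i ≠ 0`. -/
def blowupModel {I E : Type*} [Fintype I] (C : I → Set E) : Set (E × (I → ℝ)) :=
  {q | q.2 ∈ stdSimplex ℝ I ∧ ∀ i, q.2 i ≠ 0 → q.1 ∈ C i}

section Model

variable {I E : Type*} [Fintype I] {C : I → Set E}

theorem convex_blowupModel_right (C : I → Set E) (x : E) :
    Convex ℝ {a | (x, a) ∈ blowupModel C} := by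
  intro a ha b hb s t hs ht hst
  refine ⟨convex_stdSimplex ℝ I ha.1 hb.1 hs ht hst, fun i hi => ?_⟩
  by_contra hx
  have h1 : a i = 0 := by_contra fun h => hx (ha.2 i h)
  have h2 : b i = 0 := by_contra fun h => hx (hb.2 i h)
  exact hi (by simp [h1, h2])

theorem convex_blowupModel_left [AddCommGroup E] [Module ℝ E] (hC : ∀ i, Convex ℝ (C i))
    (a : I → ℝ) : Convex ℝ {x | (x, a) ∈ blowupModel C} :=
  fun _ hx _ hy _ _ hs ht hst => ⟨hx.1, fun i hi => hC i (hx.2 i hi) (hy.2 i hi) hs ht hst⟩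

theorem segment_subset_blowupModel_right [AddCommGroup E] [Module ℝ E] {x : E} {a b : I → ℝ}
    (ha : (x, a) ∈ blowupModel C) (hb : (x, b) ∈ blowupModel C) :
    segment ℝ (x, a) (x, b) ⊆ blowupModel C := by
  refine (((convex_singleton x).prod (convex_blowupModel_right C x)).segment_subset
    (mk_mem_prod rfl ha) (mk_mem_prod rfl hb)).trans ?_
  rintro ⟨y, c⟩ ⟨rfl, hc⟩
  exact hc

theorem segment_subset_blowupModel_left [AddCommGroup E] [Module ℝ E] (hC : ∀ i, Convex ℝ (C i))
    {x y : E} {a : I → ℝ} (hx : (x, a) ∈ blowupModel C) (hy : (y, a) ∈ blowupModel C) :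
    segment ℝ (x, a) (y, a) ⊆ blowupModel C := by
  refine (((convex_blowupModel_left hC a).prod (convex_singleton a)).segment_subset
    (mk_mem_prod hx rfl) (mk_mem_prod hy rfl)).trans ?_
  rintro ⟨y, c⟩ ⟨hy, rfl⟩
  exact hy

/-- Nonnegative weights on the index set that exceed the level `T` somewhere and whose support
indexes sets with a common point. -/
def admissibleWeights (C : I → Set E) (T : ℝ) : Set (I → ℝ) :=
  {b | (∀ i, 0 ≤ b i) ∧ (∃ i, T < b i) ∧ ∃ x, ∀ i, b i ≠ 0 → x ∈ C i}

/-- Admissible weights `b` select continuously a point of the blowup model: its coordinates are the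
normalized truncations `(b - T)⁺`, and its base point averages chosen points `p J ∈ ⋂ i ∈ J, C i`
over the sets `J` with `{T ≤ b} ⊆ J ⊆ {0 < b}`. All these `p J` lie in the convex set
`⋂ i ∈ {T ≤ b}, C i`, which contains the average. -/
theorem exists_continuousOn_selection [AddCommGroup E] [Module ℝ E] [TopologicalSpace E]
    [ContinuousAdd E] [ContinuousSMul ℝ E] (hC : ∀ i, Convex ℝ (C i)) {T : ℝ} (hT : 0 < T) :
    ∃ (s : (I → ℝ) → E) (r : (I → ℝ) → I → ℝ),
      ContinuousOn s (admissibleWeights C T) ∧ ContinuousOn r (admissibleWeights C T) ∧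
      ∀ b ∈ admissibleWeights C T, (s b, r b) ∈ blowupModel C ∧ ∀ i, r b i ≠ 0 ↔ T < b i := by
  classical
  have hp : ∀ J : Finset I, ∃ p : E, (∃ x, ∀ i ∈ J, x ∈ C i) → ∀ i ∈ J, p ∈ C i := by
    intro J
    by_cases h : ∃ x, ∀ i ∈ J, x ∈ C i
    · exact h.imp fun x hx _ => hx
    · exact ⟨0, fun h' => absurd h' h⟩
  choose p hp using hp
  -- `w b J` is positive exactly when `{T ≤ b} ⊆ J ⊆ {0 < b}`
  let w : (I → ℝ) → Finset I → ℝ := fun b J =>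
    (∏ k ∈ Jᶜ, max (T - b k) 0) * ∏ i ∈ J, b i
  let m : (I → ℝ) → ℝ := fun b => ∑ j, max (b j - T) 0
  have hwc : ∀ J, Continuous fun b => w b J := fun J => by fun_prop
  have hmc : Continuous m := by fun_prop
  have hw0 : ∀ b ∈ admissibleWeights C T, ∀ J, 0 ≤ w b J := fun b hb J =>
    mul_nonneg (Finset.prod_nonneg fun _ _ => le_max_right _ _)
      (Finset.prod_nonneg fun i _ => hb.1 i)
  have hwpos : ∀ b ∈ admissibleWeights C T, 0 < ∑ J, w b J := by
    intro b hb
    refine Finset.sum_pos' (fun J _ => hw0 b hb J)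
      ⟨Finset.univ.filter fun i => T ≤ b i, Finset.mem_univ _, mul_pos ?_ ?_⟩
    · refine Finset.prod_pos fun k hk => lt_max_of_lt_left ?_
      simpa using hk
    · exact Finset.prod_pos fun i hi => hT.trans_le (by simpa using hi)
  have hmpos : ∀ b ∈ admissibleWeights C T, 0 < m b := by
    rintro b ⟨-, ⟨i, hi⟩, -⟩
    exact Finset.sum_pos' (fun _ _ => le_max_right _ _)
      ⟨i, Finset.mem_univ _, lt_max_of_lt_left (sub_pos.2 hi)⟩
  have hsupp : ∀ b ∈ admissibleWeights C T, ∀ i, max (b i - T) 0 / m b ≠ 0 ↔ T < b i := by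
    intro b hb i
    rw [div_ne_zero_iff, and_iff_left (hmpos b hb).ne', ne_eq, max_eq_right_iff, sub_nonpos, not_le]
  refine ⟨fun b => Finset.univ.centerMass (w b) p, fun b i => max (b i - T) 0 / m b,
    ?_, ?_, fun b hb => ⟨⟨⟨fun i => ?_, ?_⟩, fun i hi => ?_⟩, hsupp b hb⟩⟩
  · refine ContinuousOn.smul (ContinuousOn.inv₀ ?_ fun b hb => (hwpos b hb).ne') ?_
    · fun_prop
    · exact (continuous_finsetSum _ fun J _ => (hwc J).smul continuous_const).continuousOn
  · exact continuousOn_pi.2 fun i => ContinuousOn.div (by fun_prop) hmc.continuousOn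
      fun b hb => (hmpos b hb).ne'
  · exact div_nonneg (le_max_right _ _) (hmpos b hb).le
  · rw [← Finset.sum_div]
    exact div_self (hmpos b hb).ne'
  · have hbi : T < b i := (hsupp b hb i).1 hi
    change Finset.univ.centerMass (w b) p ∈ C i
    rw [← Finset.centerMass_filter_ne_zero]
    refine (hC i).centerMass_mem (fun J _ => hw0 b hb J) ?_ fun J hJ => ?_
    · rw [Finset.sum_filter_ne_zero]
      exact hwpos b hb
    · have hJ' : w b J ≠ 0 := (Finset.mem_filter.1 hJ).2
      obtain ⟨h1, h2⟩ := mul_ne_zero_iff.1 hJ'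
      obtain ⟨x, hx⟩ := hb.2.2
      refine hp J ⟨x, fun j hj => hx j (Finset.prod_ne_zero_iff.1 h2 j hj)⟩ i ?_
      by_contra hiJ
      refine Finset.prod_ne_zero_iff.1 h1 i (Finset.mem_compl.2 hiJ) ?_
      exact max_eq_right (by linarith)

end Model

/-! ### Bump functions with the nerve of the cover -/

theorem IsClosed.exists_continuous_zero_iff {X : Type*} [PseudoMetricSpace X] {s : Set X}
    (hs : IsClosed s) : ∃ d : X → ℝ, Continuous d ∧ (∀ x, 0 ≤ d x) ∧ ∀ x, d x = 0 ↔ x ∈ s := by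
  rcases s.eq_empty_or_nonempty with rfl | hne
  · exact ⟨fun _ => 1, continuous_const, fun _ => zero_le_one, fun _ => by simp⟩
  · exact ⟨fun x => Metric.infDist x s, Metric.continuous_infDist_pt s,
      fun _ => Metric.infDist_nonneg, fun x => (hs.mem_iff_infDist_zero hne).symm⟩

/-- A finite family of closed sets admits bump functions, equal to `1` on the given sets, such that
sets whose bump functions are simultaneously nonzero at a point have a common point. -/
theorem exists_bump_of_isClosed {I X : Type*} [Fintype I] [PseudoMetricSpace X] {C : I → Set X}
    (hC : ∀ i, IsClosed (C i)) :
    ∃ b : X → I → ℝ, Continuous b ∧ (∀ x i, 0 ≤ b x i) ∧ (∀ i, ∀ x ∈ C i, b x i = 1) ∧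
      ∀ x, ∃ y, ∀ i, b x i ≠ 0 → y ∈ C i := by
  classical
  choose d hdc hd0 hd using fun i => (hC i).exists_continuous_zero_iff
  -- the sets of indices whose members have no common point
  let bad : Finset (Finset I) := Finset.univ.filter fun J => ∀ y, ∃ i ∈ J, y ∉ C i
  have hD : ∀ J ∈ bad, ∀ x, 0 < ∑ k ∈ J, d k x := by
    intro J hJ x
    obtain ⟨i, hi, hx⟩ := (Finset.mem_filter.1 hJ).2 x
    exact Finset.sum_pos' (fun k _ => hd0 k x)
      ⟨i, hi, (hd0 i x).lt_of_ne' fun h => hx ((hd i x).1 h)⟩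
  -- at any point of `X`, the factors for a fixed `J` cannot all be positive: some `d i` with `i ∈ J`
  -- is at least the average of the `d k` with `k ∈ J`
  refine ⟨fun x i => ∏ J ∈ bad with i ∈ J, max (1 - J.card * d i x / ∑ k ∈ J, d k x) 0,
    ?_, fun x i => Finset.prod_nonneg fun _ _ => le_max_right _ _, fun i x hx => ?_, fun x => ?_⟩
  · refine continuous_pi fun i => continuous_finsetProd _ fun J hJ => ?_
    refine (continuous_const.sub (Continuous.div ?_ ?_ fun x => ?_)).max continuous_const
    · exact continuous_const.mul (hdc i)
    · exact continuous_finsetSum _ fun k _ => hdc k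
    · exact (hD J (Finset.mem_filter.1 hJ).1 x).ne'
  · refine Finset.prod_eq_one fun J _ => ?_
    simp [(hd i x).2 hx]
  · by_contra! hcon
    set J : Finset I := Finset.univ.filter fun i =>
      ∏ J ∈ bad with i ∈ J, max (1 - J.card * d i x / ∑ k ∈ J, d k x) 0 ≠ 0 with hJ
    have hJbad : J ∈ bad := Finset.mem_filter.2 ⟨Finset.mem_univ _, fun y => by
      obtain ⟨i, hi, hy⟩ := hcon y
      exact ⟨i, Finset.mem_filter.2 ⟨Finset.mem_univ _, hi⟩, hy⟩⟩
    have hlt : ∀ i ∈ J, J.card * d i x < ∑ k ∈ J, d k x := by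
      intro i hi
      have h := Finset.prod_ne_zero_iff.1 (Finset.mem_filter.1 hi).2 J
        (Finset.mem_filter.2 ⟨hJbad, hi⟩)
      by_contra! hle
      refine h (max_eq_right (sub_nonpos.2 ?_))
      rwa [one_le_div (hD J hJbad x)]
    have hne : J.Nonempty := by
      obtain ⟨i, hi, -⟩ := (Finset.mem_filter.1 hJbad).2 x
      exact ⟨i, hi⟩
    have := Finset.sum_lt_sum_of_nonempty hne hlt
    rw [← Finset.mul_sum, Finset.sum_const, nsmul_eq_mul] at this
    exact this.false

/-! ### The homotopy equivalences -/

namespace IndexedCover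

section ClosedConvex

theorem isClosed_set_of_image {I E : Type*} [TopologicalSpace E] {X : Set E}
    {C : IndexedCover I X} (hcl : ∀ i, IsClosed ((↑) '' C.set i : Set E)) (i : I) :
    IsClosed (C.set i) := by
  rw [← preimage_image_eq (C.set i) Subtype.val_injective]
  exact (hcl i).preimage continuous_subtype_val

variable {I E : Type*} [Fintype I] [NormedAddCommGroup E] {X : Set E}
  {C : IndexedCover I X}

/-- The embedding of the blowup complex into the ambient vector space. -/
noncomputable def ambientCoord (C : IndexedCover I X) (z : Blowup C) : E × (I → ℝ) :=
  ((C.rhoS z : E), (C.rhoN z).coord)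

theorem isEmbedding_ambientCoord (hcl : ∀ i, IsClosed ((↑) '' C.set i : Set E)) :
    IsEmbedding C.ambientCoord :=
  (IsEmbedding.subtypeVal.prodMap IsEmbedding.id).comp
    (isClosedEmbedding_blowupCoord (isClosed_set_of_image hcl)).isEmbedding

theorem range_ambientCoord :
    range C.ambientCoord = blowupModel fun i => ((↑) '' C.set i : Set E) := by
  have h : range C.ambientCoord =
      Prod.map Subtype.val _root_.id '' range C.blowupCoord :=
    range_comp (Prod.map Subtype.val _root_.id) C.blowupCoord
  rw [h, range_blowupCoord]
  ext ⟨x, a⟩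
  constructor
  · rintro ⟨⟨y, b⟩, ⟨hb, hy⟩, hq⟩
    obtain ⟨rfl, rfl⟩ := Prod.ext_iff.1 hq
    exact ⟨hb, fun i hi => ⟨y, hy i hi, rfl⟩⟩
  · rintro ⟨ha, hx⟩
    -- the coordinates sum to `1`, so one of them is nonzero and `x` lies in `X`
    obtain ⟨i, -, hi⟩ : ∃ i ∈ Finset.univ, a i ≠ 0 :=
      Finset.exists_ne_zero_of_sum_ne_zero (by rw [ha.2]; exact one_ne_zero)
    obtain ⟨y, -, rfl⟩ := hx i hi
    refine ⟨(y, a), ⟨ha, fun j hj => ?_⟩, rfl⟩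
    obtain ⟨y', hy', h⟩ := hx j hj
    rwa [← Subtype.ext h]

theorem ambientCoord_mem (z : Blowup C) :
    ((C.rhoS z : E), (C.rhoN z).coord) ∈ blowupModel fun i => ((↑) '' C.set i : Set E) :=
  range_ambientCoord (C := C) ▸ mem_range_self z

theorem mem_range_coord_of_mem_blowupModel {q : E × (I → ℝ)}
    (hq : q ∈ blowupModel fun i => ((↑) '' C.set i : Set E)) :
    q.2 ∈ range (Realization.coord (K := C.nerve)) := by
  rw [← range_ambientCoord] at hq
  obtain ⟨z, rfl⟩ := hq
  exact mem_range_self _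

variable [NormedSpace ℝ E]

/-- Two maps into the blowup complex are homotopic if straight-line homotopies inside the model
join both of them to an intermediate map `h`. -/
theorem homotopic_of_two_segments (hcl : ∀ i, IsClosed ((↑) '' C.set i : Set E))
    {W : Type*} [TopologicalSpace W] {f g : C(W, Blowup C)} {h : W → E × (I → ℝ)}
    (hh : Continuous h)
    (h1 : ∀ w, segment ℝ (C.ambientCoord (f w)) (h w) ⊆
      blowupModel fun i => ((↑) '' C.set i : Set E))
    (h2 : ∀ w, segment ℝ (h w) (C.ambientCoord (g w)) ⊆
      blowupModel fun i => ((↑) '' C.set i : Set E)) : f.Homotopic g := by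
  have he := isEmbedding_ambientCoord hcl
  obtain ⟨k, hk⟩ := he.exists_lift hh fun w => by
    rw [range_ambientCoord]; exact h1 w (right_mem_segment ℝ _ _)
  refine (ContinuousMap.homotopic_of_segment_subset_range he (g := k) fun w => ?_).trans
    (ContinuousMap.homotopic_of_segment_subset_range he fun w => ?_)
  · rw [range_ambientCoord, hk]; exact h1 w
  · rw [range_ambientCoord, hk]; exact h2 w

/-- Truncating the coordinates `a` at the level `1 / (n + 1)`, with `n` the number of cover elements,
leaves a nonzero family, so that the continuous selection provides a homotopy inverse. -/
theorem isHomotopyEquiv_rhoN (hcl : ∀ i, IsClosed ((↑) '' C.set i : Set E))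
    (hcv : ∀ i, Convex ℝ ((↑) '' C.set i : Set E)) : IsHomotopyEquiv C.rhoN := by
  set D : I → Set E := fun i => ((↑) '' C.set i : Set E)
  have hT : (0 : ℝ) < 1 / (Fintype.card I + 1) := by positivity
  obtain ⟨s, r, hs, hr, hsr⟩ := exists_continuousOn_selection hcv hT
  have hadm : ∀ y : Realization C.nerve,
      y.coord ∈ admissibleWeights D (1 / (Fintype.card I + 1)) := by
    intro y
    obtain ⟨z, rfl⟩ := C.surjective_rhoN y
    have hz := ambientCoord_mem z
    refine ⟨hz.1.1, ?_, _, hz.2⟩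
    by_contra! hle
    have h1 := Finset.sum_le_sum fun i (_ : i ∈ Finset.univ) => hle i
    rw [hz.1.2, Finset.sum_const, nsmul_eq_mul, Finset.card_univ, mul_one_div,
      one_le_div (by positivity)] at h1
    linarith
  have hcs : Continuous fun y : Realization C.nerve => s y.coord :=
    hs.comp_continuous Realization.continuous_coord hadm
  have hcr : Continuous fun y : Realization C.nerve => r y.coord :=
    hr.comp_continuous Realization.continuous_coord hadm
  obtain ⟨g, hg⟩ := (isEmbedding_ambientCoord hcl).exists_lift (hcs.prodMk hcr) fun y => by
    rw [range_ambientCoord]; exact (hsr _ (hadm y)).1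
  -- the support of the truncation is contained in the support of the given coordinates
  have hmid : ∀ z, ((C.rhoS z : E), r (C.rhoN z).coord) ∈ blowupModel D := fun z =>
    ⟨(hsr _ (hadm _)).1.1, fun i hi => (ambientCoord_mem z).2 i
      (hT.trans (((hsr _ (hadm _)).2 i).1 hi)).ne'⟩
  refine .of_homotopic g ?_ ?_
  · refine homotopic_of_two_segments hcl
      (h := fun z => ((C.rhoS z : E), r (C.rhoN z).coord)) ?_ (fun z => ?_) fun z => ?_
    · exact (continuous_subtype_val.comp C.rhoS.continuous).prodMk
        (hcr.comp C.rhoN.continuous)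
    · rw [ContinuousMap.comp_apply, hg]
      exact segment_subset_blowupModel_left hcv (hsr _ (hadm _)).1 (hmid z)
    · exact segment_subset_blowupModel_right (hmid z) (ambientCoord_mem z)
  · refine ContinuousMap.homotopic_of_segment_subset_range
      Realization.isClosedEmbedding_coord.isEmbedding fun y => ?_
    obtain ⟨z, rfl⟩ := C.surjective_rhoN y
    have hgy : (C.rhoN (g (C.rhoN z))).coord = r (C.rhoN z).coord :=
      (Prod.ext_iff.1 (hg (C.rhoN z))).2
    intro a ha
    rw [ContinuousMap.comp_apply, hgy] at ha
    exact mem_range_coord_of_mem_blowupModel ((convex_blowupModel_right D (C.rhoS z)).segment_subset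
      (hmid z) (ambientCoord_mem z) ha)

/-- Bump functions around the cover elements are admissible weights; they exceed the level `1 / 2`
at the indices of all cover elements containing the given point, so that the selected point lies in
every cover element that contains the given one. -/
theorem isHomotopyEquiv_rhoS (hcl : ∀ i, IsClosed ((↑) '' C.set i : Set E))
    (hcv : ∀ i, Convex ℝ ((↑) '' C.set i : Set E)) : IsHomotopyEquiv C.rhoS := by
  set D : I → Set E := fun i => ((↑) '' C.set i : Set E)
  obtain ⟨s, r, hs, hr, hsr⟩ := exists_continuousOn_selection hcv one_half_pos
  obtain ⟨b, hbc, hb0, hb1, hb⟩ := exists_bump_of_isClosed (isClosed_set_of_image hcl)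
  have hlt : ∀ i, ∀ x ∈ C.set i, 1 / 2 < b x i := fun i x hx => by
    rw [hb1 i x hx]; norm_num
  have hadm : ∀ x, b x ∈ admissibleWeights D (1 / 2) := by
    intro x
    obtain ⟨i, hi⟩ := mem_iUnion.1 (C.iUnion_eq ▸ mem_univ x)
    obtain ⟨y, hy⟩ := hb x
    exact ⟨hb0 x, ⟨i, hlt i x hi⟩, y, fun j hj => ⟨y, hy j hj, rfl⟩⟩
  have hcs : Continuous fun x => s (b x) := hs.comp_continuous hbc hadm
  have hcr : Continuous fun x => r (b x) := hr.comp_continuous hbc hadm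
  obtain ⟨g, hg⟩ := (isEmbedding_ambientCoord hcl).exists_lift (hcs.prodMk hcr) fun x => by
    rw [range_ambientCoord]; exact (hsr _ (hadm x)).1
  have hmem : ∀ x i, x ∈ C.set i → s (b x) ∈ D i := fun x i hx =>
    (hsr _ (hadm x)).1.2 i (((hsr _ (hadm x)).2 i).2 (hlt i x hx))
  have hmid : ∀ z, (s (b (C.rhoS z)), (C.rhoN z).coord) ∈ blowupModel D := fun z =>
    ⟨(ambientCoord_mem z).1, fun i hi => by
      obtain ⟨x, hx, h⟩ := (ambientCoord_mem z).2 i hi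
      exact hmem _ i (Subtype.ext h ▸ hx)⟩
  refine .of_homotopic g ?_ ?_
  · refine homotopic_of_two_segments hcl
      (h := fun z => (s (b (C.rhoS z)), (C.rhoN z).coord)) ?_ (fun z => ?_) fun z => ?_
    · exact (hcs.comp C.rhoS.continuous).prodMk
        (Realization.continuous_coord.comp C.rhoN.continuous)
    · rw [ContinuousMap.comp_apply, hg]
      exact segment_subset_blowupModel_right (hsr _ (hadm _)).1 (hmid z)
    · exact segment_subset_blowupModel_left hcv (hmid z) (ambientCoord_mem z)
  · refine ContinuousMap.homotopic_of_segment_subset_range IsEmbedding.subtypeVal fun x => ?_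
    obtain ⟨i, hi⟩ := mem_iUnion.1 (C.iUnion_eq ▸ mem_univ x)
    have hgx : (C.rhoS (g x) : E) = s (b x) := (Prod.ext_iff.1 (hg x)).1
    rw [ContinuousMap.comp_apply, hgx, Subtype.range_coe]
    refine ((hcv i).segment_subset (hmem x i hi) ⟨x, hi, rfl⟩).trans ?_
    rintro _ ⟨y, -, rfl⟩
    exact y.2

end ClosedConvex

end IndexedCover

end

theorem mainTheorem2 :
    -- both natural maps are homotopy equivalences for finite closed convex covers
    (∀ {d : ℕ} {I : Type*} [Finite I] (X : Set (EuclideanSpace ℝ (Fin d)))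
      (C : IndexedCover I X),
      (∀ i, IsClosed ((↑) '' C.set i : Set (EuclideanSpace ℝ (Fin d)))) →
      (∀ i, Convex ℝ ((↑) '' C.set i : Set (EuclideanSpace ℝ (Fin d)))) →
      IsHomotopyEquiv C.rhoS ∧ IsHomotopyEquiv C.rhoN) ∧
    -- the blowup complex and the realized nerve are functorial in morphisms of covered spaces
    (∀ {I X : Type*} [TopologicalSpace X] (U : IndexedCover I X),
      (IndexedCover.Hom.id U).blowupMap = ContinuousMap.id _ ∧
      (IndexedCover.Hom.id U).nerveMap = ContinuousMap.id _) ∧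
    (∀ {I X L Y M Z : Type*} [TopologicalSpace X] [TopologicalSpace Y] [TopologicalSpace Z]
      {U : IndexedCover I X} {V : IndexedCover L Y} {W : IndexedCover M Z}
      (g : V.Hom W) (f : U.Hom V),
      (g.comp f).blowupMap = g.blowupMap.comp f.blowupMap ∧
      (g.comp f).nerveMap = g.nerveMap.comp f.nerveMap) ∧
    -- both maps are natural in morphisms of covered spaces
    (∀ {I X L Y : Type*} [TopologicalSpace X] [TopologicalSpace Y]
      {U : IndexedCover I X} {V : IndexedCover L Y} (f : U.Hom V),
      V.rhoS.comp f.blowupMap = f.map.comp U.rhoS ∧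
      V.rhoN.comp f.blowupMap = f.nerveMap.comp U.rhoN) := by
  refine ⟨fun {_ I _} X C hcl hcv => ?_, fun U => ⟨IndexedCover.Hom.blowupMap_id U,
    IndexedCover.Hom.nerveMap_id U⟩, fun g f => ⟨IndexedCover.Hom.blowupMap_comp g f,
    IndexedCover.Hom.nerveMap_comp g f⟩, fun f => ⟨IndexedCover.rhoS_comp_blowupMap f,
    IndexedCover.rhoN_comp_blowupMap f⟩⟩
  have := Fintype.ofFinite I
  exact ⟨IndexedCover.isHomotopyEquiv_rhoS hcl hcv, IndexedCover.isHomotopyEquiv_rhoN hcl hcv⟩
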